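/- Let two spherically symmetric spacetime regions be given, with metrics $g=\gamma_{AB}(x)\,dx^A dx^B+R(x)^2 d\Omega^2$ and $\tilde g=\tilde\gamma_{AB}(\tilde x)\,d\tilde x^A d\tilde x^B+\tilde R(\tilde x)^2 d\Omega^2$, where $\gamma,\tilde\gamma$ are two-dimensional Lorentzian metrics, $R,\tilde R>0$ ($\gamma, R, \tilde\gamma,\tilde R$ of class $C^2$), and $d\Omega^2$ is the metric of the unit 2-sphere. Let $u^a$ be a unit timelike and $e^a$ a unit spacelike vector field in region 1 ($C^1$, rotationally invariant, orthogonal to each other and to the spheres, i.e. the 2-sheets), put $h_{ab}=g_{ab}+u_au_b$, $N_{ab}=h_{ab}-e_ae_b$, let $\mathrm D$ be the covariant derivative projected with $h_{ab}$ on all indices, and let $$\Theta=\mathrm D_au^a,\qquad \Sigma=\bigl(\mathrm D_{(a}u_{b)}-\tfrac13\Theta h_{ab}\bigr)e^ae^b,\qquad \phi=N^{ab}\mathrm D_ae_b$$ be the expansion, the shear scalar and the sheet expansion. Let $K$ be the Gaussian curvature of the 2-sheets with the metric $N_{ab}$, and $$\mathcal M=\frac1{2\sqrt K}\Bigl(1-\frac1{4K^3}\nabla_aK\nabla^aK\Bigr)$$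 the Misner--Sharp mass. The same quantities of region 2 carry a tilde. Let $S$ be a timelike hypersurface which inherits the spherical symmetry: it is swept out in either region by the 2-sheets over a regular $C^3$ curve in the $[u,e]$-plane, the 2-sheets in the two regions being identified with each other, and its unit normals are $n_a=\alpha u_a+\beta e_a$ with $\beta^2=1+\alpha^2$ and $\tilde n_a=\tilde\alpha\tilde u_a+\tilde\beta\tilde e_a$ with $\tilde\beta^2=1+\tilde\alpha^2$. Suppose that the Israel--Darmois matching conditions hold on $S$: the first fundamental forms of $S$ induced from the two regions (and so, in particular, the sheet metrics $N_{ab}$ and $\tilde N_{ab}$) are equal, and the second fundamental forms of $S$ with respect to $n$ and $\tilde n$ are equal. Then at every point of $S$ $$K=\tilde K,\qquad \mathcal M=\tilde{\mathcal M},\qquad \tfrac14\phi^2-\bigl(\tfrac13\Theta-\tfrac12\Sigma\bigr)^2=\tfrac14\tilde\phi^2-\bigl(\tfrac13\tilde\Theta-\tfrac12\tilde\Sigma\bigr)^2 .$$ -/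

import Mathlib

open scoped ContDiff

noncomputable section

namespace Matching

/-! ### Tensor calculus in a coordinate chart

Coordinates are indexed by a finite type `ι`; a point is its tuple of coordinates `ι → ℝ`, and a
metric is the matrix field of its components `g_{ab}`. -/

/-- The partial derivative `∂_i f` at the point `p`. -/
def pd {ι : Type} [Fintype ι] [DecidableEq ι] (i : ι) (f : (ι → ℝ) → ℝ) (p : ι → ℝ) : ℝ :=
  fderiv ℝ f p (Pi.single i 1)

/-- The Christoffel symbol of the second kind
`Γ^k_{ij} = ½ g^{kl} (g_{jl,i} + g_{li,j} - g_{ij,l})`. -/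
def christoffel {ι : Type} [Fintype ι] [DecidableEq ι] (g : (ι → ℝ) → Matrix ι ι ℝ)
    (p : ι → ℝ) (k i j : ι) : ℝ :=
  1 / 2 * ∑ l, (g p)⁻¹ k l *
    (pd i (fun q => g q j l) p + pd j (fun q => g q l i) p - pd l (fun q => g q i j) p)

/-- The covector field `v_a = g_{ab} v^b` of a vector field `v^a`. -/
def lower {ι : Type} [Fintype ι] (g : (ι → ℝ) → Matrix ι ι ℝ) (v : (ι → ℝ) → ι → ℝ)
    (p : ι → ℝ) (a : ι) : ℝ :=
  ∑ b, g p a b * v p b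

/-- The Levi-Civita covariant derivative `∇_a w_b = ∂_a w_b - Γ^c_{ab} w_c` of a covector field. -/
def covDeriv {ι : Type} [Fintype ι] [DecidableEq ι] (g : (ι → ℝ) → Matrix ι ι ℝ)
    (w : (ι → ℝ) → ι → ℝ) (p : ι → ℝ) (a b : ι) : ℝ :=
  pd a (fun q => w q b) p - ∑ c, christoffel g p c a b * w p c

/-- The Ricci tensor
`R_{ij} = ∂_k Γ^k_{ij} - ∂_j Γ^k_{ik} + Γ^k_{kl} Γ^l_{ij} - Γ^k_{jl} Γ^l_{ik}`. -/
def ricci {ι : Type} [Fintype ι] [DecidableEq ι] (g : (ι → ℝ) → Matrix ι ι ℝ)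
    (p : ι → ℝ) (i j : ι) : ℝ :=
  ∑ k, (pd k (fun q => christoffel g q k i j) p - pd j (fun q => christoffel g q k i k) p
    + ∑ l, (christoffel g p k k l * christoffel g p l i j
      - christoffel g p k j l * christoffel g p l i k))

/-- The scalar curvature `g^{ij} R_{ij}`. -/
def scalarCurvature {ι : Type} [Fintype ι] [DecidableEq ι] (g : (ι → ℝ) → Matrix ι ι ℝ)
    (p : ι → ℝ) : ℝ :=
  ∑ i, ∑ j, (g p)⁻¹ i j * ricci g p i j

/-- The Gaussian curvature `K` of a metric on a surface: in dimension two `R_{ij} = K g_{ij}`,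
hence `K` is half the scalar curvature. -/
def gaussianCurvature (g : (Fin 2 → ℝ) → Matrix (Fin 2) (Fin 2) ℝ) (y : Fin 2 → ℝ) : ℝ :=
  1 / 2 * scalarCurvature g y

/-! ### Fundamental forms of a parametrized hypersurface -/

/-- The first fundamental form `h_{ab} = g_{μν}(X(ξ)) ∂_a X^μ ∂_b X^ν` of `X`. -/
def firstForm {κ ι : Type} [Fintype κ] [DecidableEq κ] [Fintype ι]
    (g : (ι → ℝ) → Matrix ι ι ℝ) (X : (κ → ℝ) → ι → ℝ) (ξ : κ → ℝ) (a b : κ) : ℝ :=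
  ∑ μ, ∑ ν, g (X ξ) μ ν * pd a (fun η => X η μ) ξ * pd b (fun η => X η ν) ξ

/-- The second fundamental form
`χ_{ab} = -n_μ (∂_a ∂_b X^μ + Γ^μ_{ρν}(X(ξ)) ∂_a X^ρ ∂_b X^ν)` of `X` with respect to the
covector field `n_μ` along `X`. -/
def secondForm {κ ι : Type} [Fintype κ] [DecidableEq κ] [Fintype ι] [DecidableEq ι]
    (g : (ι → ℝ) → Matrix ι ι ℝ) (X : (κ → ℝ) → ι → ℝ) (n : (κ → ℝ) → ι → ℝ)
    (ξ : κ → ℝ) (a b : κ) : ℝ :=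
  -∑ μ, n ξ μ * (pd a (fun η => pd b (fun ζ => X ζ μ) η) ξ
    + ∑ ρ, ∑ ν, christoffel g (X ξ) μ ρ ν *
        pd a (fun η => X η ρ) ξ * pd b (fun η => X η ν) ξ)

/-! ### The 1+1+2 decomposition of a four-dimensional spacetime -/

/-- Indices of the four spacetime coordinates: two coordinates `x` on the `[u,e]`-plane (`inl`) and
two coordinates `y` on the sheets (`inr`). -/
abbrev Idx : Type := Fin 2 ⊕ Fin 2

/-- The projection `h^a_b = δ^a_b + u^a u_b` orthogonal to `u`. -/
def spatialProj (g : (Idx → ℝ) → Matrix Idx Idx ℝ) (u : (Idx → ℝ) → Idx → ℝ)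
    (p : Idx → ℝ) (a b : Idx) : ℝ :=
  (if a = b then 1 else 0) + u p a * lower g u p b

/-- The fully projected derivative `D_a v_b = h^c_a h^d_b ∇_c v_d` of a vector field `v`. -/
def spatialDeriv (g : (Idx → ℝ) → Matrix Idx Idx ℝ) (u v : (Idx → ℝ) → Idx → ℝ)
    (p : Idx → ℝ) (a b : Idx) : ℝ :=
  ∑ c, ∑ d, spatialProj g u p c a * spatialProj g u p d b * covDeriv g (lower g v) p c d

/-- The volume expansion `Θ = D_a u^a`. -/
def expansion (g : (Idx → ℝ) → Matrix Idx Idx ℝ) (u : (Idx → ℝ) → Idx → ℝ) (p : Idx → ℝ) : ℝ :=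
  ∑ a, ∑ b, (g p)⁻¹ a b * spatialDeriv g u u p a b

/-- The shear tensor `σ_{ab} = D_{⟨a} u_{b⟩} = D_{(a} u_{b)} - ⅓ Θ h_{ab}`. -/
def shearTensor (g : (Idx → ℝ) → Matrix Idx Idx ℝ) (u : (Idx → ℝ) → Idx → ℝ)
    (p : Idx → ℝ) (a b : Idx) : ℝ :=
  1 / 2 * (spatialDeriv g u u p a b + spatialDeriv g u u p b a)
    - 1 / 3 * expansion g u p * (g p a b + lower g u p a * lower g u p b)

/-- The shear scalar `Σ = σ_{ab} e^a e^b`. -/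
def shear (g : (Idx → ℝ) → Matrix Idx Idx ℝ) (u e : (Idx → ℝ) → Idx → ℝ) (p : Idx → ℝ) : ℝ :=
  ∑ a, ∑ b, shearTensor g u p a b * e p a * e p b

/-- The sheet metric `N_{ab} = g_{ab} + u_a u_b - e_a e_b`. -/
def sheetTensor (g : (Idx → ℝ) → Matrix Idx Idx ℝ) (u e : (Idx → ℝ) → Idx → ℝ)
    (p : Idx → ℝ) : Matrix Idx Idx ℝ :=
  Matrix.of fun a b => g p a b + lower g u p a * lower g u p b - lower g e p a * lower g e p b

/-- The expansion of the sheet, `φ = N^{ab} D_a e_b` with `N^{ab} = g^{ab} + u^a u^b - e^a e^b`. -/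
def sheetExpansion (g : (Idx → ℝ) → Matrix Idx Idx ℝ) (u e : (Idx → ℝ) → Idx → ℝ)
    (p : Idx → ℝ) : ℝ :=
  ∑ a, ∑ b, ((g p)⁻¹ a b + u p a * u p b - e p a * e p b) * spatialDeriv g u e p a b

/-- The Gaussian curvature `K` of the 2-sheet `x = const` through `p`, i.e. of the metric which
`N_{ab}` induces on it. -/
def sheetCurvature (g : (Idx → ℝ) → Matrix Idx Idx ℝ) (u e : (Idx → ℝ) → Idx → ℝ)
    (p : Idx → ℝ) : ℝ :=
  gaussianCurvature
    (fun y => (sheetTensor g u e (Sum.elim (fun i => p (Sum.inl i)) y)).toBlocks₂₂)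
    (fun i => p (Sum.inr i))

/-- The Misner-Sharp mass `1 / (2 √K) * (1 - ∇_a K ∇^a K / (4 K³))`. -/
def misnerSharpMass (g : (Idx → ℝ) → Matrix Idx Idx ℝ) (u e : (Idx → ℝ) → Idx → ℝ)
    (p : Idx → ℝ) : ℝ :=
  1 / (2 * √(sheetCurvature g u e p)) *
    (1 - 1 / (4 * sheetCurvature g u e p ^ 3) *
      ∑ a, ∑ b, (g p)⁻¹ a b * pd a (sheetCurvature g u e) p * pd b (sheetCurvature g u e) p)

/-! ### Spherically symmetric regions and their symmetric boundary hypersurfaces -/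

/-- A spherically symmetric region of spacetime in coordinates `(x, y)` adapted to the symmetry:
`ds² = γ_{AB}(x) dx^A dx^B + R(x)² dΩ²`, where `γ` is a Lorentzian metric, `R` is the area radius and
`dΩ²` is the metric of the unit 2-sphere in arbitrary local coordinates `y`; and a unit timelike
field `u` and a unit spacelike field `e`, invariant under the rotations and orthogonal to the
spheres. -/
structure SphericalRegion where
  /-- the domain of the coordinates `x` -/
  Q : Set (Fin 2 → ℝ)
  isOpen_Q : IsOpen Q
  /-- the domain of the coordinates `y` on the sphere -/
  V : Set (Fin 2 → ℝ)
  isOpen_V : IsOpen V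
  /-- the components `γ_{AB}` -/
  γ : (Fin 2 → ℝ) → Matrix (Fin 2) (Fin 2) ℝ
  γ_contDiffOn : ∀ A B, ContDiffOn ℝ 2 (fun x => γ x A B) Q
  γ_symm : ∀ x ∈ Q, (γ x).IsSymm
  /-- the area radius -/
  R : (Fin 2 → ℝ) → ℝ
  R_contDiffOn : ContDiffOn ℝ 2 R Q
  R_pos : ∀ x ∈ Q, 0 < R x
  /-- the local parametrization of the unit sphere of Euclidean 3-space by the coordinates `y` -/
  Y : (Fin 2 → ℝ) → EuclideanSpace ℝ (Fin 3)
  Y_contDiffOn : ContDiffOn ℝ ∞ Y V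
  Y_norm : ∀ y ∈ V, ‖Y y‖ = 1
  Y_immersion : ∀ y ∈ V, Function.Injective (fderiv ℝ Y y)
  /-- the components of the timelike field `u` -/
  u : (Fin 2 → ℝ) → Fin 2 → ℝ
  u_contDiffOn : ContDiffOn ℝ 1 u Q
  /-- the components of the spacelike field `e` -/
  e : (Fin 2 → ℝ) → Fin 2 → ℝ
  e_contDiffOn : ContDiffOn ℝ 1 e Q
  -- The next three conditions also force `γ` to be nondegenerate of signature `(-, +)`.
  u_unit : ∀ x ∈ Q, ∑ A, ∑ B, γ x A B * u x A * u x B = -1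
  e_unit : ∀ x ∈ Q, ∑ A, ∑ B, γ x A B * e x A * e x B = 1
  u_orth_e : ∀ x ∈ Q, ∑ A, ∑ B, γ x A B * u x A * e x B = 0

namespace SphericalRegion

/-- The components of the unit sphere metric `dΩ²` in the coordinates `y`. -/
def sphereMetric (G : SphericalRegion) (y : Fin 2 → ℝ) : Matrix (Fin 2) (Fin 2) ℝ :=
  Matrix.of fun i j =>
    inner ℝ (fderiv ℝ G.Y y (Pi.single i 1)) (fderiv ℝ G.Y y (Pi.single j 1))

/-- The spacetime metric `γ_{AB}(x) dx^A dx^B + R(x)² dΩ²`. -/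
def metric (G : SphericalRegion) (p : Idx → ℝ) : Matrix Idx Idx ℝ :=
  Matrix.fromBlocks (G.γ fun i => p (Sum.inl i)) 0 0
    (G.R (fun i => p (Sum.inl i)) ^ 2 • G.sphereMetric fun i => p (Sum.inr i))

/-- `u` as a vector field `u^a` on spacetime. -/
def uField (G : SphericalRegion) (p : Idx → ℝ) : Idx → ℝ :=
  Sum.elim (G.u fun i => p (Sum.inl i)) 0

/-- `e` as a vector field `e^a` on spacetime. -/
def eField (G : SphericalRegion) (p : Idx → ℝ) : Idx → ℝ :=
  Sum.elim (G.e fun i => p (Sum.inl i)) 0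

/-- The volume expansion `Θ`. -/
def Theta (G : SphericalRegion) (p : Idx → ℝ) : ℝ := expansion G.metric G.uField p

/-- The shear scalar `Σ`. -/
def Sigma (G : SphericalRegion) (p : Idx → ℝ) : ℝ := shear G.metric G.uField G.eField p

/-- The sheet expansion `φ`. -/
def phi (G : SphericalRegion) (p : Idx → ℝ) : ℝ := sheetExpansion G.metric G.uField G.eField p

/-- The Gaussian curvature `K` of the 2-sheets. -/
def K (G : SphericalRegion) (p : Idx → ℝ) : ℝ := sheetCurvature G.metric G.uField G.eField p

/-- The Misner-Sharp mass. -/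
def mass (G : SphericalRegion) (p : Idx → ℝ) : ℝ := misnerSharpMass G.metric G.uField G.eField p

end SphericalRegion

/-- Indices of the intrinsic coordinates `ξ = (s, y)` of a hypersurface: the parameter `s` of a curve
in the `[u,e]`-plane and the two coordinates `y` on the sheets. -/
abbrev SurfIdx : Type := Unit ⊕ Fin 2

/-- The points `(s, y)` with `s ∈ J` and `y ∈ W`. -/
def surfDomain (J : Set ℝ) (W : Set (Fin 2 → ℝ)) : Set (SurfIdx → ℝ) :=
  {ξ | ξ (Sum.inl ()) ∈ J ∧ (fun i => ξ (Sum.inr i)) ∈ W}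

/-- The hypersurface `(s, y) ↦ (c(s), y)` swept out by the sheets over a curve `c`. -/
def sweep (c : ℝ → Fin 2 → ℝ) (ξ : SurfIdx → ℝ) : Idx → ℝ :=
  Sum.elim (c (ξ (Sum.inl ()))) (fun i => ξ (Sum.inr i))

/-- A timelike hypersurface of a spherically symmetric region which inherits the symmetry, with
intrinsic coordinates `(s, y) ∈ J × W`, and a unit normal `n_a = α u_a + β e_a` of it. -/
structure TimelikeBoundary (G : SphericalRegion) (J : Set ℝ) (W : Set (Fin 2 → ℝ)) where
  /-- the curve in the `[u,e]`-plane -/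
  c : ℝ → Fin 2 → ℝ
  c_contDiffOn : ContDiffOn ℝ 3 c J
  c_mem : ∀ s ∈ J, c s ∈ G.Q
  c_regular : ∀ s ∈ J, deriv c s ≠ 0
  W_subset : W ⊆ G.V
  /-- the component `α` of the normal -/
  α : ℝ → ℝ
  /-- the component `β` of the normal -/
  β : ℝ → ℝ
  unit : ∀ s ∈ J, β s ^ 2 = 1 + α s ^ 2
  normal : ∀ ξ ∈ surfDomain J W, ∀ a : SurfIdx,
    ∑ μ, (α (ξ (Sum.inl ())) * lower G.metric G.uField (sweep c ξ) μ
      + β (ξ (Sum.inl ())) * lower G.metric G.eField (sweep c ξ) μ)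
        * pd a (fun η => sweep c η μ) ξ = 0

namespace TimelikeBoundary

/-- The embedding `X` of the hypersurface. -/
def X {G : SphericalRegion} {J : Set ℝ} {W : Set (Fin 2 → ℝ)} (S : TimelikeBoundary G J W) :
    (SurfIdx → ℝ) → Idx → ℝ :=
  sweep S.c

/-- The unit normal `n_a = α u_a + β e_a`. -/
def n {G : SphericalRegion} {J : Set ℝ} {W : Set (Fin 2 → ℝ)} (S : TimelikeBoundary G J W)
    (ξ : SurfIdx → ℝ) (a : Idx) : ℝ :=
  S.α (ξ (Sum.inl ())) * lower G.metric G.uField (S.X ξ) a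
    + S.β (ξ (Sum.inl ())) * lower G.metric G.eField (S.X ξ) a

/-- The first fundamental form of the hypersurface. -/
def h {G : SphericalRegion} {J : Set ℝ} {W : Set (Fin 2 → ℝ)} (S : TimelikeBoundary G J W) :
    (SurfIdx → ℝ) → SurfIdx → SurfIdx → ℝ :=
  firstForm G.metric S.X

/-- The second fundamental form of the hypersurface. -/
def χ {G : SphericalRegion} {J : Set ℝ} {W : Set (Fin 2 → ℝ)} (S : TimelikeBoundary G J W) :
    (SurfIdx → ℝ) → SurfIdx → SurfIdx → ℝ :=
  secondForm G.metric S.X S.n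

end TimelikeBoundary

end Matching

end

/-!
Write `u(R) = u^A ∂_A R`, and similarly for other fields in the `[u,e]`-plane, and let `σ` be the unit
sphere metric. In coordinates adapted to the symmetry everything reduces to the area radius `R`:

* `Γ^A_{ij} = -R γ^{AB} ∂_B R σ_{ij}`, so `∇_i v_j = R v(R) σ_{ij}` for every field `v` in the
  `[u,e]`-plane (`covDeriv_planeField_inr_inr`). Tracing over the sheets gives `φ = 2 e(R) / R`
  (`phi_eq`), and `Θ/3 - Σ/2 = u(R) / R` (`Theta_sub_Sigma_eq`). By the completeness relation
  `γ^{AB} = -u^A u^B + e^A e^B`, the third quantity of the theorem is therefore `∇_a R ∇^a R / R²`.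
* `K` is `R⁻²` times the curvature of `σ` (`K_eq`), so that `∇_a K ∇^a K` is the sum of
  `4 K² ∇_a R ∇^a R / R²` and a term intrinsic to the sheets (`sum_inv_metric_pd_K`). That the
  curvature of `σ` is `1` plays no role: the intrinsic term and `K` itself match because the sheet
  metrics do.

It remains to match `∇_a R ∇^a R / R²` (`gradSq_matching`). The unit tangent of the curve is, up to
sign, `t = β u + α e`, and `∇_a R ∇^a R = n(R)² - t(R)²`. On the sheets the fundamental forms are
`h_{ij} = R² σ_{ij}` and `χ_{ij} = R n(R) σ_{ij}`, so their equality matches `n(R) / R`. The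
derivative of `h_{ij}` along the curve matches the derivative of `log R` along the curve, which is
`t(R) / R` times a factor `l` with `l² = -h_{ss}`; since `h_{ss}` matches, so does `(t(R) / R)²`.
-/

noncomputable section

namespace Matching

/-! ### Partial derivatives -/

/-- No regularity is needed: at a point where `f` is not differentiable, `fderiv` is zero. -/
theorem pd_eq_zero_of_forall {ι : Type} [Fintype ι] [DecidableEq ι] {i : ι} {f : (ι → ℝ) → ℝ}
    {p : ι → ℝ} (hf : ∀ t : ℝ, f (p + t • Pi.single i 1) = f p) : pd i f p = 0 := by
  unfold pd
  by_cases h : DifferentiableAt ℝ f p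
  · rw [← h.lineDeriv_eq_fderiv, lineDeriv]
    simp [hf]
  · simp [fderiv_zero_of_not_differentiableAt h]

theorem pd_const {ι : Type} [Fintype ι] [DecidableEq ι] (i : ι) (c : ℝ) (p : ι → ℝ) :
    pd i (fun _ => c) p = 0 := by
  simp [pd]

theorem pd_congr {ι : Type} [Fintype ι] [DecidableEq ι] {i : ι} {f g : (ι → ℝ) → ℝ}
    {p : ι → ℝ} (h : f =ᶠ[nhds p] g) : pd i f p = pd i g p := by
  unfold pd; rw [h.fderiv_eq]

theorem pd_const_mul {ι : Type} [Fintype ι] [DecidableEq ι] (i : ι) (c : ℝ) (f : (ι → ℝ) → ℝ)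
    (p : ι → ℝ) : pd i (fun q => c * f q) p = c * pd i f p := by
  have h : fderiv ℝ (fun q => c * f q) p = c • fderiv ℝ f p :=
    congrFun (fderiv_const_smul_field (𝕜 := ℝ) c (f := f)) p
  rw [pd, h]; rfl

theorem pd_coord {ι : Type} [Fintype ι] [DecidableEq ι] (i j : ι) (p : ι → ℝ) :
    pd i (fun q => q j) p = if j = i then 1 else 0 := by
  have : HasFDerivAt (fun q : ι → ℝ => q j) (ContinuousLinearMap.proj (R := ℝ) j) p :=
    hasFDerivAt_apply j p
  simp [pd, this.fderiv, Pi.single_apply]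

/-- The product rule for a function of `x` times a function of `y`. -/
theorem hasFDerivAt_inl_mul_inr {f k : (Fin 2 → ℝ) → ℝ} {p : Idx → ℝ}
    (hf : DifferentiableAt ℝ f fun i => p (Sum.inl i))
    (hk : DifferentiableAt ℝ k fun i => p (Sum.inr i)) :
    HasFDerivAt (fun q : Idx → ℝ => f (fun i => q (Sum.inl i)) * k fun i => q (Sum.inr i))
      (f (fun i => p (Sum.inl i)) • (fderiv ℝ k fun i => p (Sum.inr i)).comp
          (ContinuousLinearMap.pi fun i : Fin 2 => ContinuousLinearMap.proj (R := ℝ)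
            (φ := fun _ : Idx => ℝ) (Sum.inr i))
        + k (fun i => p (Sum.inr i)) • (fderiv ℝ f fun i => p (Sum.inl i)).comp
          (ContinuousLinearMap.pi fun i : Fin 2 => ContinuousLinearMap.proj (R := ℝ)
            (φ := fun _ : Idx => ℝ) (Sum.inl i))) p :=
  (hf.hasFDerivAt.comp p (ContinuousLinearMap.pi fun i : Fin 2 => ContinuousLinearMap.proj (R := ℝ)
      (φ := fun _ : Idx => ℝ) (Sum.inl i)).hasFDerivAt).mul
    (hk.hasFDerivAt.comp p (ContinuousLinearMap.pi fun i : Fin 2 =>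
      ContinuousLinearMap.proj (R := ℝ) (φ := fun _ : Idx => ℝ) (Sum.inr i)).hasFDerivAt)

theorem pd_inl_mul {f k : (Fin 2 → ℝ) → ℝ} {p : Idx → ℝ} (A : Fin 2)
    (hf : DifferentiableAt ℝ f fun i => p (Sum.inl i))
    (hk : DifferentiableAt ℝ k fun i => p (Sum.inr i)) :
    pd (Sum.inl A) (fun q => f (fun i => q (Sum.inl i)) * k fun i => q (Sum.inr i)) p
      = pd A f (fun i => p (Sum.inl i)) * k fun i => p (Sum.inr i) := by
  have e1 : (fun i : Fin 2 => (Pi.single (Sum.inl A) 1 : Idx → ℝ) (Sum.inl i)) = Pi.single A 1 := by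
    ext i; simp [Pi.single_apply]
  rw [pd, (hasFDerivAt_inl_mul_inr hf hk).fderiv]
  simp [e1, pd, mul_comm]
  exact Or.inr (map_zero _)

theorem pd_inr_mul {f k : (Fin 2 → ℝ) → ℝ} {p : Idx → ℝ} (j : Fin 2)
    (hf : DifferentiableAt ℝ f fun i => p (Sum.inl i))
    (hk : DifferentiableAt ℝ k fun i => p (Sum.inr i)) :
    pd (Sum.inr j) (fun q => f (fun i => q (Sum.inl i)) * k fun i => q (Sum.inr i)) p
      = f (fun i => p (Sum.inl i)) * pd j k fun i => p (Sum.inr i) := by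
  have e2 : (fun i : Fin 2 => (Pi.single (Sum.inr j) 1 : Idx → ℝ) (Sum.inr i)) = Pi.single j 1 := by
    ext i; simp [Pi.single_apply]
  rw [pd, (hasFDerivAt_inl_mul_inr hf hk).fderiv]
  simp [e2, pd]
  exact Or.inr (map_zero _)

theorem contDiffOn_pd {ι : Type} [Fintype ι] [DecidableEq ι] {V : Set (ι → ℝ)} (hV : IsOpen V)
    {f : (ι → ℝ) → ℝ} (hf : ContDiffOn ℝ ∞ f V) (i : ι) : ContDiffOn ℝ ∞ (pd i f) V :=
  (hf.fderiv_of_isOpen hV (by simp)).clm_apply contDiffOn_const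

/-! ### Gaussian curvature: constant rescaling and regularity -/

/-- The nonsingular inverse of a degenerate matrix is zero, so invertibility is not needed. -/
theorem inv_smul_of_ne_zero {ι : Type} [Fintype ι] [DecidableEq ι] {c : ℝ} (hc : c ≠ 0)
    (A : Matrix ι ι ℝ) : (c • A)⁻¹ = c⁻¹ • A⁻¹ := by
  by_cases hA : IsUnit A.det
  · exact Matrix.inv_smul' A (Units.mk0 c hc) hA
  · have h : ¬ IsUnit (c • A).det := by
      rw [Matrix.det_smul, IsUnit.mul_iff]; exact fun h => hA h.2
    rw [Matrix.nonsing_inv_apply_not_isUnit _ hA, Matrix.nonsing_inv_apply_not_isUnit _ h, smul_zero]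

theorem christoffel_const_smul {ι : Type} [Fintype ι] [DecidableEq ι] {c : ℝ} (hc : c ≠ 0)
    (g : (ι → ℝ) → Matrix ι ι ℝ) : christoffel (fun q => c • g q) = christoffel g := by
  funext p k i j
  simp only [christoffel, inv_smul_of_ne_zero hc, Matrix.smul_apply, smul_eq_mul, pd_const_mul]
  congr 1
  refine Finset.sum_congr rfl fun l _ => ?_
  field_simp

theorem gaussianCurvature_const_smul {c : ℝ} (hc : c ≠ 0)
    (g : (Fin 2 → ℝ) → Matrix (Fin 2) (Fin 2) ℝ) (y : Fin 2 → ℝ) :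
    gaussianCurvature (fun q => c • g q) y = c⁻¹ * gaussianCurvature g y := by
  have h : ricci (fun q => c • g q) = ricci g := by
    funext p i j
    simp only [ricci, christoffel_const_smul hc]
  simp only [gaussianCurvature, scalarCurvature, h, inv_smul_of_ne_zero hc, Matrix.smul_apply,
    smul_eq_mul, Finset.mul_sum]
  refine Finset.sum_congr rfl fun i _ => Finset.sum_congr rfl fun j _ => ?_
  ring

theorem gaussianCurvature_congr {g g' : (Fin 2 → ℝ) → Matrix (Fin 2) (Fin 2) ℝ} {y : Fin 2 → ℝ}
    (h : g =ᶠ[nhds y] g') : gaussianCurvature g y = gaussianCurvature g' y := by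
  have h1 : ∀ᶠ z in nhds y, ∀ k i j, christoffel g z k i j = christoffel g' z k i j := by
    filter_upwards [h.eventuallyEq_nhds] with z hz k i j
    have hd : ∀ l a b, pd l (fun q => g q a b) z = pd l (fun q => g' q a b) z := fun l a b =>
      pd_congr (hz.fun_comp (fun A => A a b))
    simp only [christoffel, hd, hz.eq_of_nhds]
  have h2 : ∀ i j, ricci g y i j = ricci g' y i j := by
    intro i j
    have hd : ∀ l a b c, pd l (fun q => christoffel g q a b c) y
        = pd l (fun q => christoffel g' q a b c) y := fun l a b c =>
      pd_congr (h1.mono fun z hz => hz a b c)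
    simp only [ricci, hd, h1.self_of_nhds]
  simp only [gaussianCurvature, scalarCurvature, h2, h.eq_of_nhds]

theorem contDiffOn_gaussianCurvature {V : Set (Fin 2 → ℝ)} (hV : IsOpen V)
    {g : (Fin 2 → ℝ) → Matrix (Fin 2) (Fin 2) ℝ}
    (hg : ∀ i j, ContDiffOn ℝ ∞ (fun y => g y i j) V) (hdet : ∀ y ∈ V, (g y).det ≠ 0) :
    ContDiffOn ℝ ∞ (gaussianCurvature g) V := by
  have hinv : ∀ i j, ContDiffOn ℝ ∞ (fun y => (g y)⁻¹ i j) V := by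
    have hd : ContDiffOn ℝ ∞ (fun y => ((g y).det)⁻¹) V := by
      refine ContDiffOn.inv ?_ hdet
      simp only [Matrix.det_fin_two]
      exact ((hg 0 0).mul (hg 1 1)).sub ((hg 0 1).mul (hg 1 0))
    intro i j
    simp only [Matrix.inv_def, Ring.inverse_eq_inv', Matrix.smul_apply, smul_eq_mul,
      Matrix.adjugate_fin_two]
    refine hd.mul ?_
    fin_cases i <;> fin_cases j
    · simpa using hg 1 1
    · simpa using (hg 0 1).neg
    · simpa using (hg 1 0).neg
    · simpa using hg 0 0
  have hΓ : ∀ k i j, ContDiffOn ℝ ∞ (fun y => christoffel g y k i j) V := by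
    intro k i j
    refine contDiffOn_const.mul (ContDiffOn.sum fun l _ => (hinv k l).mul ?_)
    exact ((contDiffOn_pd hV (hg j l) i).add (contDiffOn_pd hV (hg l i) j)).sub
      (contDiffOn_pd hV (hg i j) l)
  have hric : ∀ i j, ContDiffOn ℝ ∞ (fun y => ricci g y i j) V := by
    intro i j
    refine ContDiffOn.sum fun k _ => ((contDiffOn_pd hV (hΓ k i j) k).sub
      (contDiffOn_pd hV (hΓ k i k) j)).add (ContDiffOn.sum fun l _ => ?_)
    exact ((hΓ k k l).mul (hΓ l i j)).sub ((hΓ k j l).mul (hΓ l i k))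
  exact contDiffOn_const.mul (ContDiffOn.sum fun i _ => ContDiffOn.sum fun j _ =>
    (hinv i j).mul (hric i j))
namespace SphericalRegion

/-! ### The metric of a spherically symmetric region -/

theorem differentiableAt_R (G : SphericalRegion) {x : Fin 2 → ℝ} (hx : x ∈ G.Q) :
    DifferentiableAt ℝ G.R x :=
  (G.R_contDiffOn.differentiableOn (by simp)).differentiableAt (G.isOpen_Q.mem_nhds hx)

theorem contDiffOn_sphereMetric (G : SphericalRegion) (i j : Fin 2) :
    ContDiffOn ℝ ∞ (fun y => G.sphereMetric y i j) G.V := by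
  have h : ContDiffOn ℝ ∞ (fderiv ℝ G.Y) G.V :=
    G.Y_contDiffOn.fderiv_of_isOpen G.isOpen_V (by simp)
  exact (h.clm_apply contDiffOn_const).inner ℝ (h.clm_apply contDiffOn_const)

theorem posDef_sphereMetric (G : SphericalRegion) {y : Fin 2 → ℝ} (hy : y ∈ G.V) :
    (G.sphereMetric y).PosDef := by
  refine Matrix.posDef_gram_of_linearIndependent (𝕜 := ℝ) (E := EuclideanSpace ℝ (Fin 3))
    (v := fun i : Fin 2 => fderiv ℝ G.Y y (Pi.single i 1)) ?_
  have h := (Pi.basisFun ℝ (Fin 2)).linearIndependent.map' (fderiv ℝ G.Y y).toLinearMap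
    (LinearMap.ker_eq_bot.2 (G.Y_immersion y hy))
  simpa [Function.comp_def] using h

theorem differentiableAt_sphereMetric (G : SphericalRegion) {y : Fin 2 → ℝ} (hy : y ∈ G.V)
    (i j : Fin 2) : DifferentiableAt ℝ (fun y => G.sphereMetric y i j) y :=
  ((G.contDiffOn_sphereMetric i j).differentiableOn (by simp)).differentiableAt
    (G.isOpen_V.mem_nhds hy)

/-- The completeness relation `γ^{AB} = -u^A u^B + e^A e^B` of the frame `u, e`. -/
theorem γ_mul_frame (G : SphericalRegion) {x : Fin 2 → ℝ} (hx : x ∈ G.Q) :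
    (Matrix.of fun A B => -(G.u x A * G.u x B) + G.e x A * G.e x B) * G.γ x = 1 := by
  -- `P` has the columns `u` and `e`, and `Pᵀ γ P = diag(-1, 1) = η`; hence `P η` is inverse to `Pᵀ γ`.
  let P : Matrix (Fin 2) (Fin 2) ℝ := !![G.u x 0, G.e x 0; G.u x 1, G.e x 1]
  let η : Matrix (Fin 2) (Fin 2) ℝ := !![-1, 0; 0, 1]
  have hu := G.u_unit x hx
  have he := G.e_unit x hx
  have hue := G.u_orth_e x hx
  have hs : G.γ x 1 0 = G.γ x 0 1 := (G.γ_symm x hx).apply 0 1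
  simp only [Fin.sum_univ_two, hs] at hu he hue
  have h1 : (P.transpose * G.γ x) * (P * η) = 1 := by
    ext i j
    fin_cases i <;> fin_cases j <;>
      simp [P, η, Matrix.mul_apply, Fin.sum_univ_two, hs] <;> linarith
  have h2 := mul_eq_one_comm.1 h1
  rw [← Matrix.mul_assoc] at h2
  rw [← h2]
  congr 1
  ext i j
  fin_cases i <;> fin_cases j <;>
    simp [P, η, Matrix.mul_apply, Fin.sum_univ_two]

theorem inv_γ (G : SphericalRegion) {x : Fin 2 → ℝ} (hx : x ∈ G.Q) :
    (G.γ x)⁻¹ = Matrix.of fun A B => -(G.u x A * G.u x B) + G.e x A * G.e x B :=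
  Matrix.inv_eq_left_inv (G.γ_mul_frame hx)

theorem inv_metric (G : SphericalRegion) {p : Idx → ℝ} (hx : (fun i => p (Sum.inl i)) ∈ G.Q)
    (hy : (fun i => p (Sum.inr i)) ∈ G.V) :
    (G.metric p)⁻¹ = Matrix.fromBlocks (G.γ fun i => p (Sum.inl i))⁻¹ 0 0
      (G.R (fun i => p (Sum.inl i)) ^ 2 • G.sphereMetric fun i => p (Sum.inr i))⁻¹ := by
  refine Matrix.inv_eq_left_inv ?_
  have hσ : IsUnit (G.R (fun i => p (Sum.inl i)) ^ 2 •
      G.sphereMetric fun i => p (Sum.inr i)).det := by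
    rw [Matrix.det_smul]
    exact (IsUnit.mk0 _ (pow_ne_zero _ (pow_ne_zero _ (G.R_pos _ hx).ne'))).mul
      (IsUnit.mk0 _ (G.posDef_sphereMetric hy).det_pos.ne')
  rw [metric, Matrix.fromBlocks_multiply, G.inv_γ hx, G.γ_mul_frame hx, Matrix.nonsing_inv_mul _ hσ]
  simp

/-- The vector field on spacetime with the components `v^A(x)` in the `[u,e]`-plane and no component
along the sheets. -/
def planeField (v : (Fin 2 → ℝ) → Fin 2 → ℝ) (p : Idx → ℝ) : Idx → ℝ :=
  Sum.elim (v fun i => p (Sum.inl i)) 0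

/-- The derivative `v(R) = v^A ∂_A R` of the area radius. -/
def derivR (G : SphericalRegion) (v : (Fin 2 → ℝ) → Fin 2 → ℝ) (x : Fin 2 → ℝ) : ℝ :=
  ∑ A, v x A * pd A G.R x

theorem lower_planeField_inl (G : SphericalRegion) (v : (Fin 2 → ℝ) → Fin 2 → ℝ) (p : Idx → ℝ)
    (A : Fin 2) : lower G.metric (planeField v) p (Sum.inl A)
      = ∑ B, G.γ (fun i => p (Sum.inl i)) A B * v (fun i => p (Sum.inl i)) B := by
  simp [lower, planeField, metric]

theorem lower_planeField_inr (G : SphericalRegion) (v : (Fin 2 → ℝ) → Fin 2 → ℝ) (p : Idx → ℝ)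
    (j : Fin 2) : lower G.metric (planeField v) p (Sum.inr j) = 0 := by
  simp [lower, planeField, metric]

/-- `Γ^A_{ij} = -R γ^{AB} ∂_B R σ_{ij}`, where `σ` is the unit sphere metric. -/
theorem christoffel_metric_inl_inr_inr (G : SphericalRegion) {p : Idx → ℝ}
    (hx : (fun i => p (Sum.inl i)) ∈ G.Q) (hy : (fun i => p (Sum.inr i)) ∈ G.V) (A i j : Fin 2) :
    christoffel G.metric p (Sum.inl A) (Sum.inr i) (Sum.inr j)
      = -(G.R (fun i => p (Sum.inl i)) * G.sphereMetric (fun i => p (Sum.inr i)) i j *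
        ∑ B, (G.γ fun i => p (Sum.inl i))⁻¹ A B * pd B G.R fun i => p (Sum.inl i)) := by
  have hR := G.differentiableAt_R hx
  have hpd : ∀ B, pd B (fun x => G.R x ^ 2) (fun i => p (Sum.inl i))
      = 2 * G.R (fun i => p (Sum.inl i)) * pd B G.R fun i => p (Sum.inl i) := by
    intro B
    rw [pd, fderiv_fun_pow 2 hR]
    simp [pd]
  have hd : ∀ B, pd (Sum.inl B) (fun q => G.metric q (Sum.inr i) (Sum.inr j)) p
      = 2 * G.R (fun i => p (Sum.inl i)) * pd B G.R (fun i => p (Sum.inl i))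
        * G.sphereMetric (fun i => p (Sum.inr i)) i j := by
    intro B
    rw [← hpd B]
    exact pd_inl_mul B (hR.pow 2) (G.differentiableAt_sphereMetric hy i j)
  have h0 : ∀ a B k, pd a (fun q => G.metric q (Sum.inr k) (Sum.inl B)) p = 0 :=
    fun a B k => pd_const a 0 p
  have h0' : ∀ a B k, pd a (fun q => G.metric q (Sum.inl B) (Sum.inr k)) p = 0 :=
    fun a B k => pd_const a 0 p
  rw [christoffel, G.inv_metric hx hy]
  simp [Fintype.sum_sum_type, hd, h0, h0', Fin.sum_univ_two]
  ring

/-- `v_A γ^{AB} ∂_B R = v(R)`. -/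
theorem sum_lower_inv_γ_pd_R (G : SphericalRegion) (v : (Fin 2 → ℝ) → Fin 2 → ℝ)
    {x : Fin 2 → ℝ} (hx : x ∈ G.Q) :
    ∑ A, (∑ B, (G.γ x)⁻¹ A B * pd B G.R x) * (∑ B, G.γ x A B * v x B) = G.derivR v x := by
  have h := G.γ_mul_frame hx
  rw [← G.inv_γ hx] at h
  have hs : G.γ x 1 0 = G.γ x 0 1 := (G.γ_symm x hx).apply 0 1
  have hs' : (G.γ x)⁻¹ 1 0 = (G.γ x)⁻¹ 0 1 := by
    simp [G.inv_γ hx, mul_comm]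
  have h00 := congrFun (congrFun h 0) 0
  have h01 := congrFun (congrFun h 0) 1
  have h10 := congrFun (congrFun h 1) 0
  have h11 := congrFun (congrFun h 1) 1
  simp only [Matrix.mul_apply, Fin.sum_univ_two, Matrix.one_apply, hs, hs'] at h00 h01 h10 h11
  simp only [derivR, Fin.sum_univ_two, hs, hs']
  norm_num at h00 h01 h10 h11
  linear_combination pd 0 G.R x * v x 0 * h00 + pd 0 G.R x * v x 1 * h01
    + pd 1 G.R x * v x 0 * h10 + pd 1 G.R x * v x 1 * h11

/-- The sheets are umbilic: `∇_i v_j = R v(R) σ_{ij}` for a field `v` in the `[u,e]`-plane. -/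
theorem covDeriv_planeField_inr_inr (G : SphericalRegion) (v : (Fin 2 → ℝ) → Fin 2 → ℝ)
    {p : Idx → ℝ} (hx : (fun i => p (Sum.inl i)) ∈ G.Q) (hy : (fun i => p (Sum.inr i)) ∈ G.V)
    (i j : Fin 2) :
    covDeriv G.metric (lower G.metric (planeField v)) p (Sum.inr i) (Sum.inr j)
      = G.R (fun i => p (Sum.inl i)) * G.derivR v (fun i => p (Sum.inl i))
        * G.sphereMetric (fun i => p (Sum.inr i)) i j := by
  rw [covDeriv, Fintype.sum_sum_type]
  simp only [lower_planeField_inr, lower_planeField_inl, G.christoffel_metric_inl_inr_inr hx hy,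
    pd_const, mul_zero, Finset.sum_const_zero, ← G.sum_lower_inv_γ_pd_R v hx, Fin.sum_univ_two]
  ring

/-! ### The kinematic scalars -/

theorem spatialDeriv_planeField_inr_inr (G : SphericalRegion) (v : (Fin 2 → ℝ) → Fin 2 → ℝ)
    {p : Idx → ℝ} (hx : (fun i => p (Sum.inl i)) ∈ G.Q) (hy : (fun i => p (Sum.inr i)) ∈ G.V)
    (i j : Fin 2) :
    spatialDeriv G.metric G.uField (planeField v) p (Sum.inr i) (Sum.inr j)
      = G.R (fun i => p (Sum.inl i)) * G.derivR v (fun i => p (Sum.inl i))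
        * G.sphereMetric (fun i => p (Sum.inr i)) i j := by
  have hp : ∀ a k, spatialProj G.metric G.uField p a (Sum.inr k) = if a = Sum.inr k then 1 else 0 :=
    fun a k => by
      have : lower G.metric G.uField p (Sum.inr k) = 0 := G.lower_planeField_inr G.u p k
      simp [spatialProj, this]
  simp [spatialDeriv, hp, G.covDeriv_planeField_inr_inr v hx hy]

/-- The trace `N^{ab} D_a v_b = 2 v(R) / R` over the sheets. -/
theorem sum_sheet_spatialDeriv_planeField (G : SphericalRegion) (v : (Fin 2 → ℝ) → Fin 2 → ℝ)
    {p : Idx → ℝ} (hx : (fun i => p (Sum.inl i)) ∈ G.Q) (hy : (fun i => p (Sum.inr i)) ∈ G.V) :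
    ∑ a, ∑ b, ((G.metric p)⁻¹ a b + G.uField p a * G.uField p b - G.eField p a * G.eField p b)
        * spatialDeriv G.metric G.uField (planeField v) p a b
      = 2 * (G.derivR v (fun i => p (Sum.inl i)) / G.R fun i => p (Sum.inl i)) := by
  have hR := (G.R_pos _ hx).ne'
  have hσ : (G.sphereMetric fun i => p (Sum.inr i))⁻¹ * (G.sphereMetric fun i => p (Sum.inr i)) = 1 :=
    Matrix.nonsing_inv_mul _ (IsUnit.mk0 _ (G.posDef_sphereMetric hy).det_pos.ne')
  have hs : (G.sphereMetric fun i => p (Sum.inr i)) 1 0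
      = (G.sphereMetric fun i => p (Sum.inr i)) 0 1 :=
    real_inner_comm (F := EuclideanSpace ℝ (Fin 3)) _ _
  have h00 := congrFun (congrFun hσ 0) 0
  have h11 := congrFun (congrFun hσ 1) 1
  simp only [Matrix.mul_apply, Fin.sum_univ_two, Matrix.one_apply_eq, hs] at h00 h11
  have hll : ∀ A B, (G.metric p)⁻¹ (Sum.inl A) (Sum.inl B) + G.uField p (Sum.inl A)
      * G.uField p (Sum.inl B) - G.eField p (Sum.inl A) * G.eField p (Sum.inl B) = 0 := by
    intro A B
    simp [G.inv_metric hx hy, G.inv_γ hx, uField, eField]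
  have hlr : ∀ A j, (G.metric p)⁻¹ (Sum.inl A) (Sum.inr j) + G.uField p (Sum.inl A)
      * G.uField p (Sum.inr j) - G.eField p (Sum.inl A) * G.eField p (Sum.inr j) = 0 := by
    intro A j
    simp [G.inv_metric hx hy, uField, eField]
  have hrl : ∀ i B, (G.metric p)⁻¹ (Sum.inr i) (Sum.inl B) + G.uField p (Sum.inr i)
      * G.uField p (Sum.inl B) - G.eField p (Sum.inr i) * G.eField p (Sum.inl B) = 0 := by
    intro i B
    simp [G.inv_metric hx hy, uField, eField]
  have hrr : ∀ i j, (G.metric p)⁻¹ (Sum.inr i) (Sum.inr j) + G.uField p (Sum.inr i)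
      * G.uField p (Sum.inr j) - G.eField p (Sum.inr i) * G.eField p (Sum.inr j)
      = (G.R (fun i => p (Sum.inl i)) ^ 2)⁻¹ * (G.sphereMetric fun i => p (Sum.inr i))⁻¹ i j := by
    intro i j
    simp [G.inv_metric hx hy, inv_smul_of_ne_zero (pow_ne_zero 2 hR), uField, eField]
  simp only [Fintype.sum_sum_type, hll, hlr, hrl, hrr, G.spatialDeriv_planeField_inr_inr v hx hy,
    zero_mul, Finset.sum_const_zero, zero_add, Fin.sum_univ_two, hs]
  field_simp
  linear_combination G.derivR v (fun i => p (Sum.inl i)) * (h00 + h11)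

theorem phi_eq (G : SphericalRegion) {p : Idx → ℝ} (hx : (fun i => p (Sum.inl i)) ∈ G.Q)
    (hy : (fun i => p (Sum.inr i)) ∈ G.V) :
    G.phi p = 2 * (G.derivR G.e (fun i => p (Sum.inl i)) / G.R fun i => p (Sum.inl i)) :=
  G.sum_sheet_spatialDeriv_planeField G.e hx hy

theorem sum_lower_uField_mul (G : SphericalRegion) {p : Idx → ℝ}
    (hx : (fun i => p (Sum.inl i)) ∈ G.Q) :
    ∑ a, lower G.metric G.uField p a * G.uField p a = -1 := by
  have h1 := fun A => G.lower_planeField_inl G.u p A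
  have h2 := fun A => G.lower_planeField_inr G.u p A
  rw [← G.u_unit _ hx, Fintype.sum_sum_type]
  change ∑ A, lower G.metric (planeField G.u) p _ * _ + ∑ A, lower G.metric (planeField G.u) p _ * _
    = _
  simp only [h1, h2, uField, Sum.elim_inl, Fin.sum_univ_two]
  ring

/-- The projected derivative has no component along `u`. -/
theorem sum_spatialDeriv_uField (G : SphericalRegion) {p : Idx → ℝ}
    (hx : (fun i => p (Sum.inl i)) ∈ G.Q) (v : (Idx → ℝ) → Idx → ℝ) (b : Idx) :
    ∑ a, spatialDeriv G.metric G.uField v p a b * G.uField p a = 0 := by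
  have hp : ∀ c, ∑ a, spatialProj G.metric G.uField p c a * G.uField p a = 0 := by
    intro c
    simp only [spatialProj, add_mul, mul_assoc, Finset.sum_add_distrib, ← Finset.mul_sum,
      G.sum_lower_uField_mul hx]
    simp
  simp only [spatialDeriv, Finset.sum_mul]
  rw [Finset.sum_comm]
  refine Finset.sum_eq_zero fun c _ => ?_
  rw [Finset.sum_comm]
  refine Finset.sum_eq_zero fun d _ => ?_
  calc _ = (∑ a, spatialProj G.metric G.uField p c a * G.uField p a)
        * (spatialProj G.metric G.uField p d b * covDeriv G.metric (lower G.metric v) p c d) := by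
        rw [Finset.sum_mul]; exact Finset.sum_congr rfl fun a _ => by ring
    _ = 0 := by rw [hp, zero_mul]

theorem sum_spatialMetric_eField (G : SphericalRegion) {p : Idx → ℝ}
    (hx : (fun i => p (Sum.inl i)) ∈ G.Q) :
    ∑ a, ∑ b, (G.metric p a b + lower G.metric G.uField p a * lower G.metric G.uField p b)
      * G.eField p a * G.eField p b = 1 := by
  have hs : G.γ (fun i => p (Sum.inl i)) 1 0 = G.γ (fun i => p (Sum.inl i)) 0 1 :=
    (G.γ_symm _ hx).apply 0 1
  have h1 : ∀ A, lower G.metric G.uField p (Sum.inl A) = _ := G.lower_planeField_inl G.u p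
  have h2 : ∀ A, lower G.metric G.uField p (Sum.inr A) = _ := G.lower_planeField_inr G.u p
  have he := G.e_unit _ hx
  have hue := G.u_orth_e _ hx
  simp only [Fin.sum_univ_two, hs] at he hue
  simp only [Fintype.sum_sum_type, h1, h2, eField, Sum.elim_inl, Sum.elim_inr, metric,
    Matrix.fromBlocks_apply₁₁, Pi.zero_apply, mul_zero, Finset.sum_const_zero,
    Fin.sum_univ_two, add_zero, hs]
  set x : Fin 2 → ℝ := fun i => p (Sum.inl i)
  linear_combination he + hue * (G.γ x 0 0 * G.u x 0 * G.e x 0 + G.γ x 0 1 * G.u x 0 * G.e x 1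
    + (G.γ x 0 1 * G.u x 1 * G.e x 0 + G.γ x 1 1 * G.u x 1 * G.e x 1))

/-- Since `Θ - e^a e^b D_a u_b = N^{ab} D_a u_b`, the combination `Θ/3 - Σ/2` is half the expansion
of the sheets along `u`. -/
theorem Theta_sub_Sigma_eq (G : SphericalRegion) {p : Idx → ℝ}
    (hx : (fun i => p (Sum.inl i)) ∈ G.Q) (hy : (fun i => p (Sum.inr i)) ∈ G.V) :
    1 / 3 * G.Theta p - 1 / 2 * G.Sigma p
      = G.derivR G.u (fun i => p (Sum.inl i)) / G.R fun i => p (Sum.inl i) := by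
  set D := spatialDeriv G.metric G.uField G.uField p with hD
  have hN := G.sum_sheet_spatialDeriv_planeField G.u hx hy
  change ∑ a, ∑ b, (_ + _ - _) * D a b = _ at hN
  have huu : ∑ a, ∑ b, G.uField p a * G.uField p b * D a b = 0 := by
    rw [Finset.sum_comm]
    refine Finset.sum_eq_zero fun b _ => ?_
    have := G.sum_spatialDeriv_uField hx G.uField b
    calc _ = G.uField p b * ∑ a, D a b * G.uField p a := by
          rw [Finset.mul_sum]; exact Finset.sum_congr rfl fun a _ => by ring
      _ = 0 := by rw [hD, this, mul_zero]
  have hΘ : G.Theta p = ∑ a, ∑ b, (G.metric p)⁻¹ a b * D a b := rfl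
  have hsplit : G.Theta p + 0 - ∑ a, ∑ b, G.eField p a * G.eField p b * D a b
      = 2 * (G.derivR G.u (fun i => p (Sum.inl i)) / G.R fun i => p (Sum.inl i)) := by
    rw [← hN, hΘ, ← huu]
    simp only [add_mul, sub_mul, Finset.sum_add_distrib, Finset.sum_sub_distrib]
  have hsw : ∑ a, ∑ b, G.eField p a * G.eField p b * D b a
      = ∑ a, ∑ b, G.eField p a * G.eField p b * D a b := by
    rw [Finset.sum_comm]
    exact Finset.sum_congr rfl fun a _ => Finset.sum_congr rfl fun b _ => by ring
  have hSig : G.Sigma p = ∑ a, ∑ b, G.eField p a * G.eField p b * D a b - 1 / 3 * G.Theta p := by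
    have h1 : G.Sigma p = 1 / 2 * (∑ a, ∑ b, G.eField p a * G.eField p b * D a b
        + ∑ a, ∑ b, G.eField p a * G.eField p b * D b a)
        - 1 / 3 * G.Theta p * ∑ a, ∑ b, (G.metric p a b
          + lower G.metric G.uField p a * lower G.metric G.uField p b)
          * G.eField p a * G.eField p b := by
      simp only [Sigma, shear, Finset.mul_sum, ← Finset.sum_add_distrib, ← Finset.sum_sub_distrib]
      refine Finset.sum_congr rfl fun a _ => Finset.sum_congr rfl fun b _ => ?_
      simp only [shearTensor, Theta, ← hD]
      ring
    rw [h1, hsw, G.sum_spatialMetric_eField hx]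
    ring
  rw [hSig]
  linear_combination 1 / 2 * hsplit

/-! ### The curvature of the sheets and the Misner-Sharp mass -/

theorem sheetMetric_eq (G : SphericalRegion) (x y : Fin 2 → ℝ) :
    (sheetTensor G.metric G.uField G.eField (Sum.elim x y)).toBlocks₂₂
      = G.R x ^ 2 • G.sphereMetric y := by
  have h1 : ∀ p A, lower G.metric G.uField p (Sum.inr A) = _ := G.lower_planeField_inr G.u
  have h2 : ∀ p A, lower G.metric G.eField p (Sum.inr A) = _ := G.lower_planeField_inr G.e
  ext i j
  simp [Matrix.toBlocks₂₂, sheetTensor, h1, h2, metric]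

theorem K_eq_gaussianCurvature (G : SphericalRegion) (p : Idx → ℝ) :
    G.K p = gaussianCurvature (fun y => G.R (fun i => p (Sum.inl i)) ^ 2 • G.sphereMetric y)
      fun i => p (Sum.inr i) := by
  unfold K sheetCurvature
  congr 1
  funext y
  exact G.sheetMetric_eq _ y

/-- The sheets are spheres of radius `R`: `K` is `R⁻²` times the curvature of the unit sphere. -/
theorem K_eq (G : SphericalRegion) {p : Idx → ℝ} (hx : (fun i => p (Sum.inl i)) ∈ G.Q) :
    G.K p = (G.R (fun i => p (Sum.inl i)) ^ 2)⁻¹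
      * gaussianCurvature G.sphereMetric fun i => p (Sum.inr i) := by
  rw [K_eq_gaussianCurvature, gaussianCurvature_const_smul (pow_ne_zero 2 (G.R_pos _ hx).ne')]

theorem differentiableAt_gaussianCurvature_sphereMetric (G : SphericalRegion) {y : Fin 2 → ℝ}
    (hy : y ∈ G.V) : DifferentiableAt ℝ (gaussianCurvature G.sphereMetric) y :=
  ((contDiffOn_gaussianCurvature G.isOpen_V G.contDiffOn_sphereMetric
    fun _ hy => (G.posDef_sphereMetric hy).det_pos.ne').differentiableOn (by simp)).differentiableAt
      (G.isOpen_V.mem_nhds hy)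

theorem K_eventuallyEq (G : SphericalRegion) {p : Idx → ℝ}
    (hx : (fun i => p (Sum.inl i)) ∈ G.Q) :
    G.K =ᶠ[nhds p] fun q => (G.R (fun i => q (Sum.inl i)) ^ 2)⁻¹
      * gaussianCurvature G.sphereMetric fun i => q (Sum.inr i) := by
  have hc : Continuous fun (q : Idx → ℝ) i => q (Sum.inl i : Idx) := by fun_prop
  filter_upwards [(G.isOpen_Q.preimage hc).mem_nhds hx] with q hq
  exact G.K_eq hq

theorem pd_inl_K (G : SphericalRegion) {p : Idx → ℝ} (hx : (fun i => p (Sum.inl i)) ∈ G.Q)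
    (hy : (fun i => p (Sum.inr i)) ∈ G.V) (A : Fin 2) :
    pd (Sum.inl A) G.K p = -2 * G.K p / G.R (fun i => p (Sum.inl i))
      * pd A G.R fun i => p (Sum.inl i) := by
  have hR := G.differentiableAt_R hx
  have hR0 := (G.R_pos _ hx).ne'
  have hd : HasFDerivAt (fun x => (G.R x ^ 2)⁻¹) _ _ :=
    HasDerivAt.comp_hasFDerivAt (h₂ := fun r : ℝ => r⁻¹) (fun i => p (Sum.inl i))
      (hasDerivAt_inv (pow_ne_zero 2 hR0)) (hR.hasFDerivAt.pow 2)
  rw [pd_congr (G.K_eventuallyEq hx), pd_inl_mul (f := fun x => (G.R x ^ 2)⁻¹) A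
    hd.differentiableAt (G.differentiableAt_gaussianCurvature_sphereMetric hy), G.K_eq hx, pd,
    HasFDerivAt.fderiv hd]
  simp [pd]
  field_simp

theorem pd_inr_K (G : SphericalRegion) {p : Idx → ℝ} (hx : (fun i => p (Sum.inl i)) ∈ G.Q)
    (hy : (fun i => p (Sum.inr i)) ∈ G.V) (j : Fin 2) :
    pd (Sum.inr j) G.K p = pd j (gaussianCurvature fun y =>
      G.R (fun i => p (Sum.inl i)) ^ 2 • G.sphereMetric y) fun i => p (Sum.inr i) := by
  have hR := G.differentiableAt_R hx
  have hR0 := pow_ne_zero 2 (G.R_pos _ hx).ne'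
  have h : gaussianCurvature (fun y => G.R (fun i => p (Sum.inl i)) ^ 2 • G.sphereMetric y)
      = fun y => (G.R (fun i => p (Sum.inl i)) ^ 2)⁻¹ * gaussianCurvature G.sphereMetric y :=
    funext fun y => gaussianCurvature_const_smul hR0 _ y
  rw [pd_congr (G.K_eventuallyEq hx), pd_inr_mul (f := fun x => (G.R x ^ 2)⁻¹) j
    ((hR.pow 2).inv hR0) (G.differentiableAt_gaussianCurvature_sphereMetric hy), h, pd_const_mul]

/-- `∇_a K ∇^a K` in terms of the frame derivatives of `R` and the geometry of the sheet. -/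
theorem sum_inv_metric_pd_K (G : SphericalRegion) {p : Idx → ℝ}
    (hx : (fun i => p (Sum.inl i)) ∈ G.Q) (hy : (fun i => p (Sum.inr i)) ∈ G.V) :
    ∑ a, ∑ b, (G.metric p)⁻¹ a b * pd a G.K p * pd b G.K p
      = 4 * G.K p ^ 2 * ((G.derivR G.e (fun i => p (Sum.inl i)) / G.R fun i => p (Sum.inl i)) ^ 2
          - (G.derivR G.u (fun i => p (Sum.inl i)) / G.R fun i => p (Sum.inl i)) ^ 2)
        + ∑ i, ∑ j, (G.R (fun i => p (Sum.inl i)) ^ 2 • G.sphereMetric fun i => p (Sum.inr i))⁻¹ i j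
          * pd i (gaussianCurvature fun y => G.R (fun i => p (Sum.inl i)) ^ 2 • G.sphereMetric y)
            (fun i => p (Sum.inr i))
          * pd j (gaussianCurvature fun y => G.R (fun i => p (Sum.inl i)) ^ 2 • G.sphereMetric y)
            fun i => p (Sum.inr i) := by
  rw [G.inv_metric hx hy]
  simp only [Fintype.sum_sum_type, Matrix.fromBlocks_apply₁₁, Matrix.fromBlocks_apply₁₂,
    Matrix.fromBlocks_apply₂₁, Matrix.fromBlocks_apply₂₂, Matrix.zero_apply, zero_mul,
    Finset.sum_const_zero, add_zero, zero_add, G.pd_inr_K hx hy]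
  congr 1
  simp only [G.inv_γ hx, G.pd_inl_K hx hy, Matrix.of_apply, derivR, Fin.sum_univ_two]
  ring

end SphericalRegion
/-! ### Hypersurfaces swept out by the sheets -/

theorem pd_inl_sweep_inl {c : ℝ → Fin 2 → ℝ} {ξ : SurfIdx → ℝ}
    (hc : DifferentiableAt ℝ c (ξ (Sum.inl ()))) (A : Fin 2) :
    pd (Sum.inl ()) (fun η => sweep c η (Sum.inl A)) ξ = deriv c (ξ (Sum.inl ())) A := by
  have h1 : HasFDerivAt (fun η : SurfIdx → ℝ => η (Sum.inl ()))
      (ContinuousLinearMap.proj (R := ℝ) (Sum.inl ())) ξ := hasFDerivAt_apply _ ξ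
  have h2 := (hasDerivAt_pi.1 hc.hasDerivAt A).comp_hasFDerivAt ξ h1
  have h3 : HasFDerivAt (fun η => sweep c η (Sum.inl A)) _ ξ := h2
  rw [pd, h3.fderiv]
  simp

theorem pd_inr_sweep_inl (c : ℝ → Fin 2 → ℝ) (ξ : SurfIdx → ℝ) (j A : Fin 2) :
    pd (Sum.inr j) (fun η => sweep c η (Sum.inl A)) ξ = 0 :=
  pd_eq_zero_of_forall fun t => by simp [sweep]

theorem pd_sweep_inr (c : ℝ → Fin 2 → ℝ) (ξ : SurfIdx → ℝ) (a : SurfIdx) (j : Fin 2) :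
    pd a (fun η => sweep c η (Sum.inr j)) ξ = if Sum.inr j = a then 1 else 0 :=
  pd_coord a (Sum.inr j) ξ

namespace TimelikeBoundary

variable {G : SphericalRegion} {J : Set ℝ} {W : Set (Fin 2 → ℝ)}

theorem differentiableAt_c (S : TimelikeBoundary G J W) (hJ : IsOpen J) {s : ℝ} (hs : s ∈ J) :
    DifferentiableAt ℝ S.c s :=
  (S.c_contDiffOn.differentiableOn (by simp)).differentiableAt (hJ.mem_nhds hs)

theorem X_inl (S : TimelikeBoundary G J W) (ξ : SurfIdx → ℝ) :
    (fun i => S.X ξ (Sum.inl i)) = S.c (ξ (Sum.inl ())) := rfl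

theorem X_inr (S : TimelikeBoundary G J W) (ξ : SurfIdx → ℝ) :
    (fun i => S.X ξ (Sum.inr i)) = fun i => ξ (Sum.inr i) := rfl

theorem h_inr_inr (S : TimelikeBoundary G J W) (ξ : SurfIdx → ℝ) (i j : Fin 2) :
    S.h ξ (Sum.inr i) (Sum.inr j)
      = (G.R (S.c (ξ (Sum.inl ()))) ^ 2 • G.sphereMetric fun i => ξ (Sum.inr i)) i j := by
  simp [h, firstForm, X, pd_inr_sweep_inl, pd_sweep_inr, Fintype.sum_sum_type]
  rfl

theorem h_inl_inl (S : TimelikeBoundary G J W) (hJ : IsOpen J) {ξ : SurfIdx → ℝ}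
    (hξ : ξ ∈ surfDomain J W) :
    S.h ξ (Sum.inl ()) (Sum.inl ()) = ∑ A, ∑ B, G.γ (S.c (ξ (Sum.inl ()))) A B
      * deriv S.c (ξ (Sum.inl ())) A * deriv S.c (ξ (Sum.inl ())) B := by
  simp [h, firstForm, X, pd_inl_sweep_inl (S.differentiableAt_c hJ hξ.1), pd_sweep_inr,
    Fintype.sum_sum_type]
  rfl

/-- The second fundamental form on the sheets: `χ_{ij} = R n(R) σ_{ij}`. -/
theorem χ_inr_inr (S : TimelikeBoundary G J W) {ξ : SurfIdx → ℝ}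
    (hξ : ξ ∈ surfDomain J W) (i j : Fin 2) :
    S.χ ξ (Sum.inr i) (Sum.inr j) = G.R (S.c (ξ (Sum.inl ())))
      * (S.α (ξ (Sum.inl ())) * G.derivR G.u (S.c (ξ (Sum.inl ())))
        + S.β (ξ (Sum.inl ())) * G.derivR G.e (S.c (ξ (Sum.inl ()))))
      * G.sphereMetric (fun i => ξ (Sum.inr i)) i j := by
  have hx : (fun i => S.X ξ (Sum.inl i)) ∈ G.Q := S.c_mem _ hξ.1
  have hy : (fun i => S.X ξ (Sum.inr i)) ∈ G.V := S.W_subset hξ.2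
  have hn : ∀ A, S.n ξ (Sum.inl A) = S.α (ξ (Sum.inl ())) * ∑ B, G.γ (S.c (ξ (Sum.inl ()))) A B
        * G.u (S.c (ξ (Sum.inl ()))) B
      + S.β (ξ (Sum.inl ())) * ∑ B, G.γ (S.c (ξ (Sum.inl ()))) A B
        * G.e (S.c (ξ (Sum.inl ()))) B := by
    intro A
    have h1 := G.lower_planeField_inl G.u (S.X ξ) A
    have h2 := G.lower_planeField_inl G.e (S.X ξ) A
    rw [S.X_inl] at h1 h2
    rw [← h1, ← h2]; rfl
  have hn' : ∀ k, S.n ξ (Sum.inr k) = 0 := by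
    intro k
    have h1 : lower G.metric G.uField (S.X ξ) _ = _ := G.lower_planeField_inr G.u (S.X ξ) k
    have h2 : lower G.metric G.eField (S.X ξ) _ = _ := G.lower_planeField_inr G.e (S.X ξ) k
    simp [n, h1, h2]
  have hΓ := G.christoffel_metric_inl_inr_inr hx hy
  have hΓ' : ∀ A, ∑ ρ, ∑ ν, christoffel G.metric (S.X ξ) (Sum.inl A) ρ ν
      * pd (Sum.inr i) (fun η => S.X η ρ) ξ * pd (Sum.inr j) (fun η => S.X η ν) ξ
      = christoffel G.metric (S.X ξ) (Sum.inl A) (Sum.inr i) (Sum.inr j) := by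
    intro A
    simp [X, pd_inr_sweep_inl, pd_sweep_inr, Fintype.sum_sum_type]
  have hdd : ∀ A, pd (Sum.inr i) (fun η => pd (Sum.inr j) (fun ζ => S.X ζ (Sum.inl A)) η) ξ = 0 := by
    intro A
    simp [X, pd_inr_sweep_inl, pd_const]
  have hu := G.sum_lower_inv_γ_pd_R G.u (S.c_mem _ hξ.1)
  have he := G.sum_lower_inv_γ_pd_R G.e (S.c_mem _ hξ.1)
  simp only [χ, secondForm, Fintype.sum_sum_type (α₁ := Fin 2) (α₂ := Fin 2) (f := fun μ => S.n ξ μ * _),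
    hn', hdd, hΓ', hΓ, hn, S.X_inl, S.X_inr, zero_mul, Finset.sum_const_zero, add_zero, zero_add]
  rw [← hu, ← he]
  simp only [Fin.sum_univ_two]
  ring

/-- The tangent of the curve is a multiple of the unit timelike vector `β u + α e`, which is
orthogonal to the normal; the square of the factor is read off from the first fundamental form. -/
theorem exists_deriv_c_eq (S : TimelikeBoundary G J W) (hJ : IsOpen J) {ξ : SurfIdx → ℝ}
    (hξ : ξ ∈ surfDomain J W) :
    ∃ l : ℝ, l ≠ 0 ∧ S.h ξ (Sum.inl ()) (Sum.inl ()) = -l ^ 2 ∧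
      deriv S.c (ξ (Sum.inl ())) = l • (S.β (ξ (Sum.inl ())) • G.u (S.c (ξ (Sum.inl ())))
        + S.α (ξ (Sum.inl ())) • G.e (S.c (ξ (Sum.inl ())))) := by
  have hn := S.normal ξ hξ (Sum.inl ())
  rw [S.h_inl_inl hJ hξ]
  have hc0 := S.c_regular _ hξ.1
  have hunit := S.unit _ hξ.1
  have hx := S.c_mem _ hξ.1
  have h1 : ∀ A, lower G.metric G.uField (sweep S.c ξ) _ = _ :=
    G.lower_planeField_inl G.u (sweep S.c ξ)
  have h2 : ∀ A, lower G.metric G.eField (sweep S.c ξ) _ = _ :=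
    G.lower_planeField_inl G.e (sweep S.c ξ)
  simp only [Fintype.sum_sum_type, pd_inl_sweep_inl (S.differentiableAt_c hJ hξ.1), pd_sweep_inr,
    h1, h2, reduceCtorEq, if_false, mul_zero, Finset.sum_const_zero, add_zero] at hn
  change ∑ A, (_ * (∑ B, G.γ (S.c (ξ (Sum.inl ()))) A B * G.u (S.c (ξ (Sum.inl ()))) B)
    + _ * (∑ B, G.γ (S.c (ξ (Sum.inl ()))) A B * G.e (S.c (ξ (Sum.inl ()))) B)) * _ = 0 at hn
  generalize S.c (ξ (Sum.inl ())) = x at *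
  generalize deriv S.c (ξ (Sum.inl ())) = t at *
  generalize S.α (ξ (Sum.inl ())) = α at *
  generalize S.β (ξ (Sum.inl ())) = β at *
  have hβ : β ≠ 0 := by
    rintro rfl
    nlinarith [sq_nonneg α]
  have hs : G.γ x 1 0 = G.γ x 0 1 := (G.γ_symm x hx).apply 0 1
  have hu := G.u_unit x hx
  have he := G.e_unit x hx
  have hue := G.u_orth_e x hx
  have hf := G.γ_mul_frame hx
  have h00 := congrFun (congrFun hf 0) 0
  have h01 := congrFun (congrFun hf 0) 1
  have h10 := congrFun (congrFun hf 1) 0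
  have h11 := congrFun (congrFun hf 1) 1
  simp only [Matrix.mul_apply, Fin.sum_univ_two, Matrix.of_apply, hs, Matrix.one_apply_eq,
    Matrix.one_apply_ne (zero_ne_one (α := Fin 2)),
    Matrix.one_apply_ne (one_ne_zero (α := Fin 2))] at h00 h01 h10 h11
  simp only [Fin.sum_univ_two, hs] at hu he hue hn
  -- `t = P u + Q e`, where `P = -u·t` and `Q = e·t`.
  obtain ⟨P, hP⟩ : ∃ P, P = -∑ A, ∑ B, G.γ x A B * G.u x A * t B := ⟨_, rfl⟩
  obtain ⟨Q, hQ⟩ : ∃ Q, Q = ∑ A, ∑ B, G.γ x A B * G.e x A * t B := ⟨_, rfl⟩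
  simp only [Fin.sum_univ_two, hs] at hP hQ
  have ht0 : t 0 = P * G.u x 0 + Q * G.e x 0 := by
    rw [hP, hQ]; linear_combination -t 0 * h00 - t 1 * h01
  have ht1 : t 1 = P * G.u x 1 + Q * G.e x 1 := by
    rw [hP, hQ]; linear_combination -t 0 * h10 - t 1 * h11
  have hPQ : β * Q = α * P := by
    rw [hP, hQ]; linear_combination hn
  have hQ' : Q = P / β * α := by field_simp; linarith
  have hP' : P = P / β * β := by field_simp
  have ht : t = (P / β) • (β • G.u x + α • G.e x) := by
    funext A
    fin_cases A
    · simp only [Fin.zero_eta, Pi.smul_apply, Pi.add_apply, smul_eq_mul]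
      rw [ht0]; linear_combination G.u x 0 * hP' + G.e x 0 * hQ'
    · simp only [Fin.mk_one, Pi.smul_apply, Pi.add_apply, smul_eq_mul]
      rw [ht1]; linear_combination G.u x 1 * hP' + G.e x 1 * hQ'
  refine ⟨P / β, fun h0 => hc0 (by rw [ht, h0, zero_smul]), ?_, ht⟩
  have hsum : ∑ A, ∑ B, G.γ x A B * t A * t B = -P ^ 2 + Q ^ 2 := by
    simp only [Fin.sum_univ_two, hs, ht0, ht1]
    linear_combination P ^ 2 * hu + Q ^ 2 * he + 2 * P * Q * hue
  rw [hsum]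
  generalize P / β = l at *
  rw [hP', hQ']
  linear_combination -l ^ 2 * hunit

theorem hasDerivAt_R_comp_c (S : TimelikeBoundary G J W) (hJ : IsOpen J) {s : ℝ} (hs : s ∈ J) :
    HasDerivAt (fun s => G.R (S.c s)) (∑ A, deriv S.c s A * pd A G.R (S.c s)) s := by
  have h := (G.differentiableAt_R (S.c_mem s hs)).hasFDerivAt.comp_hasDerivAt s
    (S.differentiableAt_c hJ hs).hasDerivAt
  have ht : deriv S.c s = ∑ A, deriv S.c s A • (Pi.single A 1 : Fin 2 → ℝ) := by
    simpa using (Pi.basisFun ℝ (Fin 2)).sum_repr (deriv S.c s) |>.symm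
  have hR : fderiv ℝ G.R (S.c s) (deriv S.c s) = ∑ A, deriv S.c s A * pd A G.R (S.c s) := by
    conv_lhs => rw [ht, map_sum]
    simp [pd]
  rwa [hR] at h

end TimelikeBoundary

/-! ### Consequences of the matching conditions -/

/-- The equality of the first fundamental forms on the sheets. -/
theorem sphereMetric_matching {G₁ G₂ : SphericalRegion} {J : Set ℝ} {W : Set (Fin 2 → ℝ)}
    {S₁ : TimelikeBoundary G₁ J W} {S₂ : TimelikeBoundary G₂ J W}
    (hh : ∀ ξ ∈ surfDomain J W, ∀ a b : SurfIdx, S₁.h ξ a b = S₂.h ξ a b)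
    {s : ℝ} (hs : s ∈ J) {y : Fin 2 → ℝ} (hy : y ∈ W) :
    G₁.R (S₁.c s) ^ 2 • G₁.sphereMetric y = G₂.R (S₂.c s) ^ 2 • G₂.sphereMetric y := by
  ext i j
  have h := hh (Sum.elim (fun _ => s) y) ⟨hs, hy⟩ (Sum.inr i) (Sum.inr j)
  rwa [S₁.h_inr_inr, S₂.h_inr_inr] at h

/-- `∇_a R ∇^a R / R²` is continuous across the hypersurface. -/
theorem gradSq_matching {G₁ G₂ : SphericalRegion} {J : Set ℝ} {W : Set (Fin 2 → ℝ)}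
    (hJ : IsOpen J) {S₁ : TimelikeBoundary G₁ J W} {S₂ : TimelikeBoundary G₂ J W}
    (hh : ∀ ξ ∈ surfDomain J W, ∀ a b : SurfIdx, S₁.h ξ a b = S₂.h ξ a b)
    (hχ : ∀ ξ ∈ surfDomain J W, ∀ a b : SurfIdx, S₁.χ ξ a b = S₂.χ ξ a b)
    {ξ : SurfIdx → ℝ} (hξ : ξ ∈ surfDomain J W) :
    (G₁.derivR G₁.e (S₁.c (ξ (Sum.inl ()))) / G₁.R (S₁.c (ξ (Sum.inl ())))) ^ 2
        - (G₁.derivR G₁.u (S₁.c (ξ (Sum.inl ()))) / G₁.R (S₁.c (ξ (Sum.inl ())))) ^ 2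
      = (G₂.derivR G₂.e (S₂.c (ξ (Sum.inl ()))) / G₂.R (S₂.c (ξ (Sum.inl ())))) ^ 2
        - (G₂.derivR G₂.u (S₂.c (ξ (Sum.inl ()))) / G₂.R (S₂.c (ξ (Sum.inl ())))) ^ 2 := by
  have hσ := fun s (hs : s ∈ J) => congrFun (congrFun (sphereMetric_matching hh hs hξ.2) 0) 0
  have hk := hχ ξ hξ (Sum.inr 0) (Sum.inr 0)
  rw [S₁.χ_inr_inr hξ, S₂.χ_inr_inr hξ] at hk
  have hσ₁ : 0 < G₁.sphereMetric (fun i => ξ (Sum.inr i)) 0 0 :=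
    (G₁.posDef_sphereMetric (S₁.W_subset hξ.2)).diag_pos
  have hσ₂ : 0 < G₂.sphereMetric (fun i => ξ (Sum.inr i)) 0 0 :=
    (G₂.posDef_sphereMetric (S₂.W_subset hξ.2)).diag_pos
  obtain ⟨l₁, hl₁, hs₁, ht₁⟩ := S₁.exists_deriv_c_eq hJ hξ
  obtain ⟨l₂, -, hs₂, ht₂⟩ := S₂.exists_deriv_c_eq hJ hξ
  have hl := hh ξ hξ (Sum.inl ()) (Sum.inl ())
  rw [hs₁, hs₂, neg_inj] at hl
  have hu₁ := S₁.unit _ hξ.1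
  have hu₂ := S₂.unit _ hξ.1
  have hR₁ := G₁.R_pos _ (S₁.c_mem _ hξ.1)
  have hR₂ := G₂.R_pos _ (S₂.c_mem _ hξ.1)
  -- Differentiate `R₁² σ₁ = R₂² σ₂` along the curve.
  have hd₁ := ((S₁.hasDerivAt_R_comp_c hJ hξ.1).pow 2).mul_const
    (G₁.sphereMetric (fun i => ξ (Sum.inr i)) 0 0)
  have hd₂ := ((S₂.hasDerivAt_R_comp_c hJ hξ.1).pow 2).mul_const
    (G₂.sphereMetric (fun i => ξ (Sum.inr i)) 0 0)
  have hd := hd₁.unique (hd₂.congr_of_eventuallyEq (by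
    filter_upwards [hJ.mem_nhds hξ.1] with s hs using hσ s hs))
  have hσs := hσ _ hξ.1
  simp only [Matrix.smul_apply, smul_eq_mul] at hσs
  have hD₁ : ∑ A, deriv S₁.c (ξ (Sum.inl ())) A * pd A G₁.R (S₁.c (ξ (Sum.inl ())))
      = l₁ * (S₁.β (ξ (Sum.inl ())) * G₁.derivR G₁.u (S₁.c (ξ (Sum.inl ())))
        + S₁.α (ξ (Sum.inl ())) * G₁.derivR G₁.e (S₁.c (ξ (Sum.inl ())))) := by
    simp [ht₁, SphericalRegion.derivR, Fin.sum_univ_two]; ring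
  have hD₂ : ∑ A, deriv S₂.c (ξ (Sum.inl ())) A * pd A G₂.R (S₂.c (ξ (Sum.inl ())))
      = l₂ * (S₂.β (ξ (Sum.inl ())) * G₂.derivR G₂.u (S₂.c (ξ (Sum.inl ())))
        + S₂.α (ξ (Sum.inl ())) * G₂.derivR G₂.e (S₂.c (ξ (Sum.inl ())))) := by
    simp [ht₂, SphericalRegion.derivR, Fin.sum_univ_two]; ring
  rw [hD₁, hD₂] at hd
  norm_num at hd
  generalize G₁.derivR G₁.u (S₁.c (ξ (Sum.inl ()))) = U₁ at *
  generalize G₁.derivR G₁.e (S₁.c (ξ (Sum.inl ()))) = E₁ at *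
  generalize G₂.derivR G₂.u (S₂.c (ξ (Sum.inl ()))) = U₂ at *
  generalize G₂.derivR G₂.e (S₂.c (ξ (Sum.inl ()))) = E₂ at *
  generalize G₁.R (S₁.c (ξ (Sum.inl ()))) = R₁ at *
  generalize G₂.R (S₂.c (ξ (Sum.inl ()))) = R₂ at *
  generalize S₁.α (ξ (Sum.inl ())) = α₁ at *
  generalize S₁.β (ξ (Sum.inl ())) = β₁ at *
  generalize S₂.α (ξ (Sum.inl ())) = α₂ at *
  generalize S₂.β (ξ (Sum.inl ())) = β₂ at *
  generalize G₁.sphereMetric (fun i => ξ (Sum.inr i)) 0 0 = σ₁ at *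
  generalize G₂.sphereMetric (fun i => ξ (Sum.inr i)) 0 0 = σ₂ at *
  -- Dividing by `R₁² σ₁ = R₂² σ₂` shows that the logarithmic derivatives of `R` match.
  have hN : (α₁ * U₁ + β₁ * E₁) / R₁ = (α₂ * U₂ + β₂ * E₂) / R₂ := by
    have e₁ : (α₁ * U₁ + β₁ * E₁) / R₁ = R₁ * (α₁ * U₁ + β₁ * E₁) * σ₁ / (R₁ ^ 2 * σ₁) := by
      field_simp
    have e₂ : (α₂ * U₂ + β₂ * E₂) / R₂ = R₂ * (α₂ * U₂ + β₂ * E₂) * σ₂ / (R₂ ^ 2 * σ₂) := by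
      field_simp
    rw [e₁, e₂, hk, hσs]
  have hT : l₁ * (β₁ * U₁ + α₁ * E₁) / R₁ = l₂ * (β₂ * U₂ + α₂ * E₂) / R₂ := by
    have e₁ : l₁ * (β₁ * U₁ + α₁ * E₁) / R₁
        = 2 * R₁ * (l₁ * (β₁ * U₁ + α₁ * E₁)) * σ₁ / (2 * (R₁ ^ 2 * σ₁)) := by
      field_simp
    have e₂ : l₂ * (β₂ * U₂ + α₂ * E₂) / R₂
        = 2 * R₂ * (l₂ * (β₂ * U₂ + α₂ * E₂)) * σ₂ / (2 * (R₂ ^ 2 * σ₂)) := by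
      field_simp
    rw [e₁, e₂, hd, hσs]
  have hT2 : ((β₁ * U₁ + α₁ * E₁) / R₁) ^ 2 = ((β₂ * U₂ + α₂ * E₂) / R₂) ^ 2 := by
    refine mul_left_cancel₀ (pow_ne_zero 2 hl₁) ?_
    rw [← mul_pow, ← mul_div_assoc, hT, hl, ← mul_pow, ← mul_div_assoc]
  -- `|∇R|²` in the frame of the normal `n = α u + β e` and the tangent `β u + α e`.
  have key : ∀ α β U E R : ℝ, β ^ 2 = 1 + α ^ 2 → (E / R) ^ 2 - (U / R) ^ 2
      = ((α * U + β * E) / R) ^ 2 - ((β * U + α * E) / R) ^ 2 := by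
    intro α β U E R h
    simp only [div_pow]
    linear_combination (U ^ 2 - E ^ 2) / R ^ 2 * h
  rw [key α₁ β₁ U₁ E₁ R₁ hu₁, key α₂ β₂ U₂ E₂ R₂ hu₂, hN, hT2]

end Matching

end

open Matching in
theorem proposition2 (G₁ G₂ : SphericalRegion) (J : Set ℝ) (W : Set (Fin 2 → ℝ))
    (hJ : IsOpen J) (hW : IsOpen W)
    (S₁ : TimelikeBoundary G₁ J W) (S₂ : TimelikeBoundary G₂ J W)
    (hh : ∀ ξ ∈ surfDomain J W, ∀ a b : SurfIdx, S₁.h ξ a b = S₂.h ξ a b)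
    (hχ : ∀ ξ ∈ surfDomain J W, ∀ a b : SurfIdx, S₁.χ ξ a b = S₂.χ ξ a b)
    (ξ : SurfIdx → ℝ) (hξ : ξ ∈ surfDomain J W) :
    G₁.K (S₁.X ξ) = G₂.K (S₂.X ξ) ∧
    G₁.mass (S₁.X ξ) = G₂.mass (S₂.X ξ) ∧
    1 / 4 * G₁.phi (S₁.X ξ) ^ 2
        - (1 / 3 * G₁.Theta (S₁.X ξ) - 1 / 2 * G₁.Sigma (S₁.X ξ)) ^ 2
      = 1 / 4 * G₂.phi (S₂.X ξ) ^ 2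
        - (1 / 3 * G₂.Theta (S₂.X ξ) - 1 / 2 * G₂.Sigma (S₂.X ξ)) ^ 2 := by
  have hx₁ : (fun i => S₁.X ξ (Sum.inl i)) ∈ G₁.Q := S₁.c_mem _ hξ.1
  have hx₂ : (fun i => S₂.X ξ (Sum.inl i)) ∈ G₂.Q := S₂.c_mem _ hξ.1
  have hy₁ : (fun i => S₁.X ξ (Sum.inr i)) ∈ G₁.V := S₁.W_subset hξ.2
  have hy₂ : (fun i => S₂.X ξ (Sum.inr i)) ∈ G₂.V := S₂.W_subset hξ.2
  have hgrad := gradSq_matching hJ hh hχ hξ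
  have hmetric : ∀ y ∈ W, G₁.R (S₁.c (ξ (Sum.inl ()))) ^ 2 • G₁.sphereMetric y
      = G₂.R (S₂.c (ξ (Sum.inl ()))) ^ 2 • G₂.sphereMetric y :=
    fun y hy => sphereMetric_matching hh hξ.1 hy
  have hcurv : ∀ y ∈ W,
      gaussianCurvature (fun y => G₁.R (S₁.c (ξ (Sum.inl ()))) ^ 2 • G₁.sphereMetric y) y
      = gaussianCurvature (fun y => G₂.R (S₂.c (ξ (Sum.inl ()))) ^ 2 • G₂.sphereMetric y) y :=
    fun y hy => gaussianCurvature_congr (by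
      filter_upwards [hW.mem_nhds hy] with z hz using hmetric z hz)
  have hpd : ∀ j, pd j
        (gaussianCurvature fun y => G₁.R (S₁.c (ξ (Sum.inl ()))) ^ 2 • G₁.sphereMetric y)
        (fun i => ξ (Sum.inr i))
      = pd j (gaussianCurvature fun y => G₂.R (S₂.c (ξ (Sum.inl ()))) ^ 2 • G₂.sphereMetric y)
        fun i => ξ (Sum.inr i) :=
    fun j => pd_congr (by filter_upwards [hW.mem_nhds hξ.2] with z hz using hcurv z hz)
  have hK : G₁.K (S₁.X ξ) = G₂.K (S₂.X ξ) := by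
    rw [G₁.K_eq_gaussianCurvature, G₂.K_eq_gaussianCurvature]
    exact hcurv _ hξ.2
  refine ⟨hK, ?_, ?_⟩
  · have h₁ := G₁.sum_inv_metric_pd_K hx₁ hy₁
    have h₂ := G₂.sum_inv_metric_pd_K hx₂ hy₂
    simp only [S₁.X_inl, S₁.X_inr, S₂.X_inl, S₂.X_inr] at h₁ h₂
    rw [hgrad, hK, hmetric _ hξ.2] at h₁
    simp only [hpd] at h₁
    have h := h₁.trans h₂.symm
    change 1 / (2 * √(G₁.K (S₁.X ξ))) * (1 - 1 / (4 * G₁.K (S₁.X ξ) ^ 3) * _)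
      = 1 / (2 * √(G₂.K (S₂.X ξ))) * (1 - 1 / (4 * G₂.K (S₂.X ξ) ^ 3) * _)
    rw [hK]
    exact congrArg (fun z => 1 / (2 * √(G₂.K (S₂.X ξ))) * (1 - 1 / (4 * G₂.K (S₂.X ξ) ^ 3) * z)) h
  · rw [G₁.phi_eq hx₁ hy₁, G₂.phi_eq hx₂ hy₂, G₁.Theta_sub_Sigma_eq hx₁ hy₁,
      G₂.Theta_sub_Sigma_eq hx₂ hy₂]
    simp only [S₁.X_inl, S₂.X_inl]
    linear_combination hgrad
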